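/- \textbf{Setting.} A matching market with a student acquaintance graph consists of a finite set $I$ of students, a finite set $S$ of schools, a set $X\subseteq I\times S$ of contracts, a strict preference order $\succ_i$ of each student $i$ over her contracts and the option $\emptyset$ of being unmatched, a strict preference order $\succ_s$ of each school $s$ over students and the option of leaving a seat vacant, quotas $q_s\in\mathbb{Z}_{\ge 0}$, and an undirected graph $G=(I,E)$; $N(i)$ is the set of neighbours of $i$. All comparisons below (including those in the mechanism) are between contracts in $X$. A matching $Y\subseteq X$ contains at most one contract per student; $Y_i$ is the school of $i$, or $\emptyset$. It is feasible if at most $q_s$ students are matched to each school $s$. School $s$ is acceptable to $i$ if $(i,s)\in X$ and $s\succ_i\emptyset$. \emph{Mutually best (MB).} $(i,s)\in X$ is an MB-pair if $s\succ_i s'$ for all other schools $s'$ with $(i,s')\in X$ and $i\succ_s i'$ for all other students $i'$ with $(i',s)\in X$. $Y$ is mutually-best if it matches every MB-pair. \emph{Pareto efficient.} $Y'$ Pareto dominates $Y$ if each student $i$ either has $Y'_i=Y_i$ or is matched in $Y'$ to a school that she strictly prefers to $Y_i$, and the latter holds for at least one student. $Y$ is Pareto efficient if it is feasible and no feasible matching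 Pareto dominates it. \emph{Locally ERF-$\ell$.} Student $i'$ has justified envy toward $i$ if $(i,s)\in Y$ for some school $s$ with $(i',s)\in X$, $s\succ_{i'}Y_{i'}$ and $i'\succ_s i$. $Y$ is locally envy-receiving-free up to $\ell$ peers if every student $i$ receives justified envy from at most $\ell$ students in $N(i)$. \emph{Treewidth.} A tree decomposition of $G$ is a finite tree $T$ whose nodes carry bags $B_j\subseteq I$ such that the bags cover $I$, for each $i\in I$ the nodes whose bags contain $i$ induce a connected subtree of $T$, and each edge of $G$ is contained in some bag. Its width is the size of its largest bag minus one; the treewidth of $G$ is the minimum width of a tree decomposition of $G$. A preference $\succ_s$ over $I$ is single-peaked on $T$ if it can be constructed as follows: choose a node and rank the students in its bag from the top in some order; then, until all students are ranked, choose a node adjacent to a previously chosen node and rank the not yet ranked students of its bag, in some order, below all students ranked so far. \emph{B-LT($k+1$).} \begin{enumerate} \item Start with $Y=\emptyset$. \item Assign $i$ to $s$ for every MB-pair $(i,s)$. \item As long as some unassigned student can be assigned in one of the following two ways, choose such a student $i$ arbitrarily and assign her. If no school acceptable to $i$ has a remaining seat, $i$ is assigned to $\emptyset$. Otherwise let $s$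 be the school that $i$ prefers most among the acceptable schools with a remaining seat; if fewer than $k$ unassigned neighbours of $i$ are preferred to $i$ by $s$, assign $i$ to $s$. \item Say that $i'$ attacks $i$ if both are unassigned, $i'\in N(i)$, and the school that $i$ prefers most among the acceptable schools with a remaining seat prefers $i'$ to $i$. Choose arbitrarily a pair of students who attack each other and assign each of the two to her most preferred acceptable school with a remaining seat. \item If all students are assigned, output $Y$; otherwise go to 3. \end{enumerate} \textbf{Theorem.} Let $k\ge 1$. Suppose that $G$ has treewidth $k$, that the preference of every school over $I$ is single-peaked on some tree decomposition of $G$ of width $k$, and that $q_s\ge 1$ for every school $s$ that belongs to an MB-pair. Then, whatever choices are made, B-LT($k+1$) terminates: it never gets stuck and has no infinite run. Every matching that it outputs is feasible, Pareto efficient, locally ERF-$(k-1)$ and mutually-best. -/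

import Mathlib

/-- A matching market with a student acquaintance graph. Only the comparisons between
contracts in `X` (and the option `none`) are ever used below; a strict order on the
contracts of one agent always extends to a strict order on all of `Option _`. -/
structure Market (I S : Type*) where
  /-- the set of contracts -/
  X : Set (I × S)
  /-- `studentPref i a b`: student `i` strictly prefers `a` to `b`
  (`none` is the option of being unmatched) -/
  studentPref : I → Option S → Option S → Prop
  studentPref_order : ∀ i, IsStrictTotalOrder (Option S) (studentPref i)
  /-- `schoolPref s a b`: school `s` strictly prefers `a` to `b`
  (`none` is the option of leaving a seat vacant) -/
  schoolPref : S → Option I → Option I → Prop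
  schoolPref_order : ∀ s, IsStrictTotalOrder (Option I) (schoolPref s)
  /-- maximum quotas -/
  quota : S → ℕ
  /-- the acquaintance graph -/
  graph : SimpleGraph I

namespace Market

variable {I S : Type*} (M : Market I S)

/-- A set of contracts with at most one contract per student, written as a function
(`Y i = none`: student `i` has no contract), is feasible if it is contained in `X` and
respects the quotas. -/
def Feasible (Y : I → Option S) : Prop :=
  (∀ i s, Y i = some s → (i, s) ∈ M.X) ∧ ∀ s, {i | Y i = some s}.ncard ≤ M.quota s

/-- Student `i` has justified envy toward student `i'` in `Y`. -/
def JustifiedEnvy (Y : I → Option S) (i i' : I) : Prop :=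
  ∃ s, (i, s) ∈ M.X ∧ M.studentPref i (some s) (Y i) ∧ Y i' = some s ∧
    M.schoolPref s (some i) (some i')

/-- Every student receives justified envy from at most `l` of her neighbors. -/
def LocallyERF (l : ℕ) (Y : I → Option S) : Prop :=
  ∀ i, {i' | M.graph.Adj i i' ∧ M.JustifiedEnvy Y i' i}.ncard ≤ l

/-- `(i, s)` is a mutually-best pair. -/
def MBPair (i : I) (s : S) : Prop :=
  (i, s) ∈ M.X ∧
  (∀ s', s' ≠ s → (i, s') ∈ M.X → M.studentPref i (some s) (some s')) ∧
  (∀ i', i' ≠ i → (i', s) ∈ M.X → M.schoolPref s (some i) (some i'))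

/-- Every mutually-best pair is matched. -/
def MutuallyBest (Y : I → Option S) : Prop :=
  ∀ i s, M.MBPair i s → Y i = some s

/-- `Y' i ≻ Y i`, where the left-hand side must be an actual contract. -/
def StrictlyBetter (i : I) (a b : Option S) : Prop :=
  ∃ s, a = some s ∧ M.studentPref i (some s) b

/-- `Y` is Pareto dominated by `Y'`. -/
def ParetoDominatedBy (Y Y' : I → Option S) : Prop :=
  (∀ i, M.StrictlyBetter i (Y' i) (Y i) ∨ Y' i = Y i) ∧
    ∃ i, M.StrictlyBetter i (Y' i) (Y i)

/-- `Y` is feasible and no feasible matching Pareto dominates it. -/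
def ParetoEfficient (Y : I → Option S) : Prop :=
  M.Feasible Y ∧ ∀ Y', M.Feasible Y' → ¬ M.ParetoDominatedBy Y Y'

end Market

/-- A tree decomposition of a graph. -/
structure TreeDecomposition {I : Type*} (G : SimpleGraph I) where
  /-- number of nodes of the tree -/
  nodes : ℕ
  tree : SimpleGraph (Fin nodes)
  isTree : tree.IsTree
  bag : Fin nodes → Finset I
  cover : ∀ i, ∃ j, i ∈ bag j
  connected : ∀ i, (tree.induce {j | i ∈ bag j}).Connected
  edge : ∀ i i', G.Adj i i' → ∃ j, i ∈ bag j ∧ i' ∈ bag j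

namespace TreeDecomposition

variable {I : Type*} {G : SimpleGraph I}

/-- The width is `w`: the largest bag has `w + 1` elements. -/
def HasWidth (T : TreeDecomposition G) (w : ℕ) : Prop :=
  IsGreatest (Set.range fun j => (T.bag j).card) (w + 1)

/-- A strict preference over the vertices (`r i i'`: `i` is preferred to `i'`) is
single-peaked on `T` if it arises by visiting nodes `visit 0, …, visit m`, each one after
the first being adjacent to an earlier one, until every vertex is ranked, where at each
visit the vertices of the bag not ranked so far are ranked, in any order, below all
vertices ranked before. -/
def SinglePeaked (T : TreeDecomposition G) (r : I → I → Prop) : Prop :=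
  ∃ (m : ℕ) (visit : Fin (m + 1) → Fin T.nodes),
    (∀ t, t ≠ 0 → ∃ u, u < t ∧ T.tree.Adj (visit u) (visit t)) ∧
    (∀ i, ∃ t, i ∈ T.bag (visit t)) ∧
    (∀ i i' t, i ∈ T.bag (visit t) → (∀ u, u ≤ t → i' ∉ T.bag (visit u)) → r i i')

end TreeDecomposition

/-- The treewidth of `G` is `k`: the minimum width of a tree decomposition of `G`. -/
def HasTreewidth {I : Type*} (G : SimpleGraph I) (k : ℕ) : Prop :=
  IsLeast {w | ∃ T : TreeDecomposition G, T.HasWidth w} k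

namespace Market

variable {I S : Type*} (M : Market I S)

/-- A state of the mechanism: `none` for a student who is still unassigned,
`some none` for a student assigned to the empty set, `some (some s)` for a student
assigned to school `s`. -/
abbrev State (I S : Type*) := I → Option (Option S)

/-- `s` is acceptable to `i` and has a remaining seat. -/
def Available (σ : State I S) (i : I) (s : S) : Prop :=
  (i, s) ∈ M.X ∧ M.studentPref i (some s) none ∧
    {j | σ j = some (some s)}.ncard < M.quota s

/-- `s` is the most preferable school for `i` among the acceptable schools with a
remaining seat. -/
def IsChoice (σ : State I S) (i : I) (s : S) : Prop :=
  M.Available σ i s ∧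
    ∀ t, M.Available σ i t → t ≠ s → M.studentPref i (some s) (some t)

/-- The unassigned neighbors of `i` that school `s` prefers to `i`. -/
def Ahead (σ : State I S) (i : I) (s : S) : Set I :=
  {i' | M.graph.Adj i i' ∧ σ i' = none ∧ (i', s) ∈ M.X ∧
    M.schoolPref s (some i') (some i)}

/-- `i'` attacks `i`: the choice of `i` prefers the unassigned neighbor `i'` to `i`. -/
def Attacks (σ : State I S) (i' i : I) : Prop :=
  ∃ s, M.IsChoice σ i s ∧ i' ∈ M.Ahead σ i s

open Classical in
/-- The state after matching all mutually-best pairs (a student is in at most one). -/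
noncomputable def initState : State I S := fun i =>
  if h : ∃ s, M.MBPair i s then some (some h.choose) else none

open Classical in
/-- One greedy assignment of B-LT(`k + 1`): an unassigned student without available school
is assigned to the empty set, and an unassigned student who is within the top `k` of
herself and her unassigned neighbors at her choice is assigned to it. -/
inductive GreedyStep (k : ℕ) (σ : State I S) : State I S → Prop
  | toEmpty (i : I) (hi : σ i = none) (h : ∀ s, ¬ M.Available σ i s) :
      GreedyStep k σ (Function.update σ i (some none))
  | toSchool (i : I) (s : S) (hi : σ i = none) (hs : M.IsChoice σ i s)
      (hk : (M.Ahead σ i s).ncard < k) :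
      GreedyStep k σ (Function.update σ i (some (some s)))

open Classical in
/-- A pair of unassigned students attacking each other is assigned to their choices. -/
inductive PairStep (σ : State I S) : State I S → Prop
  | mk (i i' : I) (s s' : S) (hi : σ i = none) (hi' : σ i' = none)
      (hs : M.IsChoice σ i s) (hs' : M.IsChoice σ i' s')
      (h : M.Attacks σ i' i) (h' : M.Attacks σ i i') :
      PairStep σ
        (Function.update (Function.update σ i (some (some s))) i' (some (some s')))

/-- One step of B-LT(`k + 1`): a greedy assignment, or, if none is possible, the assignment
of a pair of students attacking each other. All the choices are arbitrary. -/
def BLTStep (k : ℕ) (σ τ : State I S) : Prop :=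
  M.GreedyStep k σ τ ∨ ((∀ ρ, ¬ M.GreedyStep k σ ρ) ∧ M.PairStep σ τ)

/-- All students are assigned (to a school or to the empty set). -/
def AllAssigned (σ : State I S) : Prop := ∀ i, σ i ≠ none

/-- `σ` is reached by some run of B-LT(`k + 1`). -/
def BLTReachable (k : ℕ) (σ : State I S) : Prop :=
  Relation.ReflTransGen (M.BLTStep k) M.initState σ

/-- B-LT(`k + 1`) terminates, whatever choices are made: there is no infinite run, and no
run gets stuck while some student is unassigned. -/
def BLTTerminates (k : ℕ) : Prop :=
  (¬ ∃ run : ℕ → State I S, run 0 = M.initState ∧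
      ∀ t, M.BLTStep k (run t) (run (t + 1))) ∧
  ∀ σ, M.BLTReachable k σ → ¬ AllAssigned σ → ∃ τ, M.BLTStep k σ τ

/-- `Y` is the output of some run of B-LT(`k + 1`). -/
def BLTOutput (k : ℕ) (Y : I → Option S) : Prop :=
  ∃ σ, M.BLTReachable k σ ∧ AllAssigned σ ∧ ∀ i, σ i = some (Y i)

end Market

/-! Single-peakedness enters through one bound: every school ranks at most `k` neighbours of a
student `i` above her. These neighbours all lie in the first visited bag containing `i`, which has
at most `k` other members (`SinglePeaked.ncard_adj_le`).

The mechanism cannot get stuck. If no greedy step is possible, every student in the set `U` of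
unassigned students is attacked by at least `k` others. Without mutual attacks, `U` would span at
least `|U| * k` edges. In the order of any one fixed school, each student has at most `k` neighbours
above her, and the top student of `U` has none in `U`, so `U` spans at most `(|U| - 1) * k` edges
(`exists_mutual`). Since each step assigns somebody, runs are finite.

The output properties are invariants. Efficiency is that of a serial dictatorship: whatever a
student prefers to her assignment was full when she was assigned. Hence envy toward `i` at `s` can
only come from students still unassigned after the step that gave `i` her seat. There are fewer than
`k` of these: by the greedy condition, or because one of at most `k` students ahead is the attacking
partner, assigned in the same step. -/

namespace TreeDecomposition

variable {I : Type*} {G : SimpleGraph I}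

/-! ### Tree decompositions: the bound on higher-ranked neighbours -/

theorem exists_walk_of_visit {n m : ℕ} {A : SimpleGraph (Fin n)} (visit : Fin (m + 1) → Fin n)
    (h : ∀ t, t ≠ 0 → ∃ u, u < t ∧ A.Adj (visit u) (visit t)) (t : Fin (m + 1)) :
    ∃ p : A.Walk (visit 0) (visit t), ∀ x ∈ p.support, ∃ u ≤ t, visit u = x := by
  induction t using WellFoundedLT.induction with
  | ind t ih =>
    by_cases ht : t = 0
    · subst ht
      exact ⟨.nil, fun x hx => ⟨0, le_rfl, (by simpa using hx : x = visit 0).symm⟩⟩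
    · obtain ⟨u, hu, ha⟩ := h t ht
      obtain ⟨p, hp⟩ := ih u hu
      refine ⟨p.concat ha, fun x hx => ?_⟩
      rw [SimpleGraph.Walk.support_concat, List.mem_append] at hx
      rcases hx with hx | hx
      · obtain ⟨w, hw, rfl⟩ := hp x hx
        exact ⟨w, hw.trans hu.le, rfl⟩
      · exact ⟨t, le_rfl, (by simpa using hx : x = visit t).symm⟩

/-- Two nodes whose bags contain `i` are joined by a path of nodes with this property. -/
theorem exists_path_of_mem_bag (T : TreeDecomposition G) {i : I} {a b : Fin T.nodes}
    (ha : i ∈ T.bag a) (hb : i ∈ T.bag b) :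
    ∃ p : T.tree.Walk a b, p.IsPath ∧ ∀ x ∈ p.support, i ∈ T.bag x := by
  classical
  obtain ⟨p⟩ := (T.connected i).preconnected ⟨a, ha⟩ ⟨b, hb⟩
  let q := p.map (SimpleGraph.Embedding.induce {j | i ∈ T.bag j}).toHom
  refine ⟨q.bypass, q.bypass_isPath, fun x hx => ?_⟩
  have hx := q.support_bypass_subset_support hx
  simp only [q, SimpleGraph.Walk.support_map, List.mem_map] at hx
  obtain ⟨y, -, rfl⟩ := hx
  exact y.2

/-- The neighbors ranked above `i` belong to the first visited bag containing `i`. -/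
theorem mem_bag_of_adj (T : TreeDecomposition G) {m : ℕ} (visit : Fin (m + 1) → Fin T.nodes)
    (h : ∀ t, t ≠ 0 → ∃ u, u < t ∧ T.tree.Adj (visit u) (visit t)) {i i' : I}
    (hadj : G.Adj i i') {t u : Fin (m + 1)} (ht : i ∈ T.bag (visit t))
    (hmin : ∀ u < t, i ∉ T.bag (visit u)) (hut : u ≤ t) (hu : i' ∈ T.bag (visit u)) :
    i' ∈ T.bag (visit t) := by
  classical
  obtain ⟨w, hw, hw'⟩ := T.edge i i' hadj
  obtain ⟨p, hp, hps⟩ := T.exists_path_of_mem_bag hu hw'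
  obtain ⟨q₂, hq₂, hqs₂⟩ := T.exists_path_of_mem_bag ht hw
  obtain ⟨a, ha⟩ := exists_walk_of_visit visit h u
  obtain ⟨b, hb⟩ := exists_walk_of_visit visit h t
  -- This path runs through nodes visited up to time `t` only, since both walks from `visit 0` do.
  let q₁ := (a.reverse.append b).bypass
  have hq₁ : q₁.IsPath := SimpleGraph.Walk.bypass_isPath _
  have hqs₁ : ∀ x ∈ q₁.support, ∃ v ≤ t, visit v = x := by
    intro x hx
    have hx := SimpleGraph.Walk.support_bypass_subset_support _ hx
    rw [SimpleGraph.Walk.mem_support_append_iff, SimpleGraph.Walk.support_reverse,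
      List.mem_reverse] at hx
    rcases hx with hx | hx
    · obtain ⟨v, hv, rfl⟩ := ha x hx
      exact ⟨v, hv.trans hut, rfl⟩
    · exact hb x hx
  -- The bags along `q₂` contain `i`, while those visited before `t` do not, so the two paths meet
  -- only at `visit t`. By uniqueness of paths in a tree, the concatenation is `p`; thus `visit t`
  -- lies on `p`, where all bags contain `i'`.
  have hpath : (q₁.append q₂).IsPath := by
    rw [SimpleGraph.Walk.isPath_def, SimpleGraph.Walk.support_append, List.nodup_append']
    refine ⟨hq₁.support_nodup, hq₂.support_nodup.sublist (List.tail_sublist _), ?_⟩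
    intro x hx₁ hx₂
    obtain ⟨v, hv, rfl⟩ := hqs₁ x hx₁
    have hvi := hqs₂ _ (List.mem_of_mem_tail hx₂)
    obtain rfl | hlt := hv.eq_or_lt
    · have := hq₂.support_nodup
      rw [← SimpleGraph.Walk.cons_tail_support, List.nodup_cons] at this
      exact this.1 hx₂
    · exact hmin v hlt hvi
  have heq := congrArg Subtype.val
    ((T.isTree.isAcyclic.subsingleton_path _ _).elim ⟨p, hp⟩ ⟨_, hpath⟩)
  apply hps
  simp only at heq
  rw [heq, SimpleGraph.Walk.mem_support_append_iff]
  exact Or.inl q₁.end_mem_support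

theorem SinglePeaked.ncard_adj_le {T : TreeDecomposition G} {k : ℕ} (hT : T.HasWidth k)
    {r : I → I → Prop} (hr : ∀ i i', r i i' → ¬ r i' i) (h : T.SinglePeaked r) (i : I) :
    {i' | G.Adj i i' ∧ r i' i}.ncard ≤ k := by
  classical
  obtain ⟨m, visit, hvisit, hcover, hrank⟩ := h
  obtain ⟨t, ht, hmin⟩ := wellFounded_lt.has_min {t | i ∈ T.bag (visit t)} (hcover i)
  have hsub : {i' | G.Adj i i' ∧ r i' i} ⊆ ((T.bag (visit t)).erase i : Finset I) := by
    rintro i' ⟨hadj, hri⟩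
    obtain ⟨u, hut, hu⟩ : ∃ u ≤ t, i' ∈ T.bag (visit u) := by
      by_contra! hne
      exact hr _ _ hri (hrank i i' t ht hne)
    simp only [Finset.coe_erase, Set.mem_sdiff, Set.mem_singleton_iff, Finset.mem_coe]
    exact ⟨T.mem_bag_of_adj visit hvisit hadj ht (fun u hu hi => hmin u hi hu) hut hu,
      hadj.ne'⟩
  have hcard : (T.bag (visit t)).card ≤ k + 1 := hT.2 ⟨_, rfl⟩
  calc _ ≤ ((T.bag (visit t)).erase i).card := by
        rw [← Set.ncard_coe_finset]
        exact Set.ncard_le_ncard hsub (Finset.finite_toSet _)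
    _ ≤ k := by rw [Finset.card_erase_of_mem ht]; omega

end TreeDecomposition

/-! ### Preferences, mutually-best pairs and choices -/

namespace Market

variable {I S : Type*} (M : Market I S)

theorem studentPref_irrefl (i : I) (a : Option S) : ¬ M.studentPref i a a :=
  (M.studentPref_order i).irrefl a

theorem studentPref_trans {i : I} {a b c : Option S} :
    M.studentPref i a b → M.studentPref i b c → M.studentPref i a c :=
  (M.studentPref_order i).trans a b c

theorem studentPref_asymm {i : I} {a b : Option S} (h : M.studentPref i a b) :
    ¬ M.studentPref i b a :=
  fun h' => M.studentPref_irrefl i a (M.studentPref_trans h h')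

theorem schoolPref_irrefl (s : S) (a : Option I) : ¬ M.schoolPref s a a :=
  (M.schoolPref_order s).irrefl a

theorem schoolPref_trans {s : S} {a b c : Option I} :
    M.schoolPref s a b → M.schoolPref s b c → M.schoolPref s a c :=
  (M.schoolPref_order s).trans a b c

theorem schoolPref_asymm {s : S} {a b : Option I} (h : M.schoolPref s a b) :
    ¬ M.schoolPref s b a :=
  fun h' => M.schoolPref_irrefl s a (M.schoolPref_trans h h')

variable {M}

theorem MBPair.school_unique {i : I} {s t : S} (h : M.MBPair i s) (h' : M.MBPair i t) :
    s = t := by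
  by_contra hne
  exact M.studentPref_asymm (h.2.1 t (Ne.symm hne) h'.1) (h'.2.1 s hne h.1)

theorem MBPair.student_unique {i j : I} {s : S} (h : M.MBPair i s) (h' : M.MBPair j s) :
    i = j := by
  by_contra hne
  exact M.schoolPref_asymm (h.2.2 j (Ne.symm hne) h'.1) (h'.2.2 i hne h.1)

theorem initState_eq_some_iff {i : I} {y : Option S} :
    M.initState i = some y ↔ ∃ s, y = some s ∧ M.MBPair i s := by
  unfold initState
  split_ifs with h
  · simp only [Option.some.injEq]
    refine ⟨fun hy => ⟨_, hy.symm, h.choose_spec⟩, ?_⟩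
    rintro ⟨s, rfl, hs⟩
    rw [h.choose_spec.school_unique hs]
  · simp only [false_iff]
    rintro ⟨s, -, hs⟩
    exact h ⟨s, hs⟩

theorem IsChoice.unique {σ : State I S} {i : I} {s t : S} (h : M.IsChoice σ i s)
    (h' : M.IsChoice σ i t) : s = t := by
  by_contra hne
  exact M.studentPref_asymm (h.2 t h'.1 (Ne.symm hne)) (h'.2 s h.1 hne)

theorem exists_isChoice [Finite S] {σ : State I S} {i : I} (h : ∃ s, M.Available σ i s) :
    ∃ s, M.IsChoice σ i s := by
  let r : S → S → Prop := fun s t => M.studentPref i (some s) (some t)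
  have : IsTrans S r := ⟨fun _ _ _ => M.studentPref_trans⟩
  have : Std.Irrefl r := ⟨fun _ => M.studentPref_irrefl i _⟩
  obtain ⟨s, hs, hmin⟩ :=
    (Finite.wellFounded_of_trans_of_irrefl r).has_min {s | M.Available σ i s} h
  refine ⟨s, hs, fun t ht hne => ?_⟩
  by_contra hst
  exact hne <| Option.some.inj <|
    (M.studentPref_order i).toTrichotomous.trichotomous _ _ (hmin t ht) hst

/-! ### Both kinds of steps as assignments to choices -/

variable (M) in
/-- The properties that greedy steps and pair steps have in common: some unassigned students
are assigned to their choices, no two of them to the same school, and fewer than `k`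
neighbors ahead of such a student stay unassigned. -/
structure ChoiceStep (k : ℕ) (σ τ : State I S) : Prop where
  mono : ∀ i y, σ i = some y → τ i = some y
  strict : ∃ i, σ i = none ∧ τ i ≠ none
  not_available : ∀ i, σ i = none → τ i = some none → ∀ s, ¬ M.Available σ i s
  isChoice : ∀ i s, σ i = none → τ i = some (some s) → M.IsChoice σ i s
  ncard_ahead : ∀ i s, σ i = none → τ i = some (some s) →
    {j | j ∈ M.Ahead σ i s ∧ τ j = none}.ncard < k
  inj : ∀ i j s, σ i = none → σ j = none → τ i = some (some s) → τ j = some (some s) → i = j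

theorem GreedyStep.choiceStep [Finite I] {k : ℕ} {σ τ : State I S} (h : M.GreedyStep k σ τ) :
    M.ChoiceStep k σ τ := by
  classical
  have key : ∀ (i j : I) (y z : Option S), σ j = none →
      Function.update σ i (some y) j = some z → j = i ∧ y = z := by
    intro i j y z hj hz
    by_cases hji : j = i
    · subst hji
      simpa using hz
    · simp [hji, hj] at hz
  have mono : ∀ (i : I) (y : Option S), σ i = none → ∀ j z, σ j = some z →
      Function.update σ i (some y) j = some z := by
    intro i y hi j z hj
    have hji : j ≠ i := by rintro rfl; simp [hi] at hj
    simpa [hji] using hj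
  cases h with
  | toEmpty i hi h =>
    refine ⟨?_, ⟨i, hi, ?_⟩, ?_, ?_, ?_, ?_⟩
    · convert mono i none hi
    · simp
    · intro j hj hτ
      obtain ⟨rfl, -⟩ := key i j none none hj (by convert hτ)
      exact h
    · intro j s hj hτ
      obtain ⟨-, h⟩ := key i j none (some s) hj (by convert hτ)
      simp at h
    · intro j s hj hτ
      obtain ⟨-, h⟩ := key i j none (some s) hj (by convert hτ)
      simp at h
    · intro j j' s hj hj' hτ
      obtain ⟨-, h⟩ := key i j none (some s) hj (by convert hτ)
      simp at h
  | toSchool i c hi hc hk =>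
    refine ⟨?_, ⟨i, hi, ?_⟩, ?_, ?_, ?_, ?_⟩
    · convert mono i (some c) hi
    · simp
    · intro j hj hτ
      obtain ⟨-, h⟩ := key i j (some c) none hj (by convert hτ)
      simp at h
    · intro j s hj hτ
      obtain ⟨rfl, h⟩ := key i j (some c) (some s) hj (by convert hτ)
      cases h
      exact hc
    · intro j s hj hτ
      obtain ⟨rfl, h⟩ := key i j (some c) (some s) hj (by convert hτ)
      cases h
      exact (Set.ncard_le_ncard (fun _ h => h.1) (Set.toFinite _)).trans_lt hk
    · intro j j' s hj hj' hτ hτ'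
      rw [(key i j (some c) (some s) hj (by convert hτ)).1,
        (key i j' (some c) (some s) hj' (by convert hτ')).1]

theorem ncard_ahead_le [Finite I] {k : ℕ} (hbound : ∀ s i,
    {i' | M.graph.Adj i i' ∧ M.schoolPref s (some i') (some i)}.ncard ≤ k)
    (σ : State I S) (i : I) (s : S) : (M.Ahead σ i s).ncard ≤ k :=
  le_trans (Set.ncard_le_ncard (fun _ h => And.intro h.1 h.2.2.2) (Set.toFinite _)) (hbound s i)

/-- The bound `hbound` allows `k` students ahead of each member of the pair; the partner is one of
them and gets assigned too, which leaves fewer than `k`. -/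
theorem PairStep.choiceStep [Finite I] {k : ℕ} (hbound : ∀ s i,
    {i' | M.graph.Adj i i' ∧ M.schoolPref s (some i') (some i)}.ncard ≤ k)
    {σ τ : State I S} (h : M.PairStep σ τ) : M.ChoiceStep k σ τ := by
  classical
  obtain ⟨i, i', s, s', hi, hi', hs, hs', h, h'⟩ := h
  obtain ⟨t, ht, ha⟩ := h
  obtain rfl := ht.unique hs
  obtain ⟨t', ht', ha'⟩ := h'
  obtain rfl := ht'.unique hs'
  have hne : i ≠ i' := ha.1.ne
  -- A common choice would prefer each of the two to the other. Distinct choices also ensure that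
  -- the two do not compete for one last seat.
  have hss : t ≠ t' := by
    rintro rfl
    exact M.schoolPref_asymm ha.2.2.2 ha'.2.2.2
  generalize hτ : Function.update (Function.update σ i (some (some t))) i' (some (some t')) = τ
  have hτi : τ i = some (some t) := by simp [← hτ, hne]
  have hτi' : τ i' = some (some t') := by simp [← hτ]
  have hτj : ∀ j, j ≠ i → j ≠ i' → τ j = σ j := by
    intro j h₁ h₂
    simp [← hτ, h₁, h₂]
  have key : ∀ j y, σ j = none → τ j = some y →
      (j = i ∧ y = some t) ∨ (j = i' ∧ y = some t') := by
    intro j y hj hy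
    by_cases h₁ : j = i
    · subst h₁
      rw [hτi] at hy
      exact Or.inl ⟨rfl, (Option.some.inj hy).symm⟩
    by_cases h₂ : j = i'
    · subst h₂
      rw [hτi'] at hy
      exact Or.inr ⟨rfl, (Option.some.inj hy).symm⟩
    rw [hτj j h₁ h₂, hj] at hy
    cases hy
  have hlt : ∀ j j' c, j' ∈ M.Ahead σ j c → τ j' ≠ none →
      {x | x ∈ M.Ahead σ j c ∧ τ x = none}.ncard < k := by
    intro j j' c hj' hτj'
    refine lt_of_lt_of_le (Set.ncard_lt_ncard ?_ (Set.toFinite _)) (ncard_ahead_le hbound σ j c)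
    exact ⟨fun _ h => h.1, fun hsub => hτj' (hsub hj').2⟩
  refine ⟨?_, ⟨i, hi, by simp [hτi]⟩, ?_, ?_, ?_, ?_⟩
  · intro j y hj
    rw [hτj j (by rintro rfl; simp [hi] at hj) (by rintro rfl; simp [hi'] at hj), hj]
  · intro j hj hy
    rcases key j _ hj hy with ⟨-, h⟩ | ⟨-, h⟩ <;> cases h
  · intro j c hj hy
    rcases key j _ hj hy with ⟨rfl, h⟩ | ⟨rfl, h⟩ <;> cases h <;> assumption
  · intro j c hj hy
    rcases key j _ hj hy with ⟨rfl, h⟩ | ⟨rfl, h⟩ <;> cases h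
    · exact hlt _ _ _ ha (by simp [hτi'])
    · exact hlt _ _ _ ha' (by simp [hτi])
  · intro j j' c hj hj' hy hy'
    rcases key j _ hj hy with ⟨rfl, h⟩ | ⟨rfl, h⟩ <;> cases h <;>
      rcases key j' _ hj' hy' with ⟨rfl, h⟩ | ⟨rfl, h⟩ <;> cases h <;>
      first | rfl | exact absurd rfl hss

theorem BLTStep.choiceStep [Finite I] {k : ℕ} (hbound : ∀ s i,
    {i' | M.graph.Adj i i' ∧ M.schoolPref s (some i') (some i)}.ncard ≤ k)
    {σ τ : State I S} (h : M.BLTStep k σ τ) : M.ChoiceStep k σ τ :=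
  h.elim GreedyStep.choiceStep fun h => h.2.choiceStep hbound

namespace ChoiceStep

variable {k : ℕ} {σ τ : State I S}

theorem ncard_unassigned_lt [Finite I] (h : M.ChoiceStep k σ τ) :
    {i | τ i = none}.ncard < {i | σ i = none}.ncard := by
  obtain ⟨i, hi, hi'⟩ := h.strict
  refine Set.ncard_lt_ncard ⟨fun j (hj : τ j = none) => ?_, fun hsub => hi' (hsub hi)⟩
    (Set.toFinite _)
  by_contra hne
  obtain ⟨y, hy⟩ := Option.ne_none_iff_exists'.1 hne
  rw [h.mono j y hy] at hj
  cases hj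

/-- A school preferred by a newly assigned student had no remaining seat. -/
theorem quota_le (h : M.ChoiceStep k σ τ) {i : I} {y : Option S} {s : S} (hi : σ i = none)
    (hy : τ i = some y) (hX : (i, s) ∈ M.X) (hs : M.studentPref i (some s) y) :
    M.quota s ≤ {j | σ j = some (some s)}.ncard := by
  by_contra! hlt
  cases y with
  | none => exact h.not_available i hi hy s ⟨hX, hs, hlt⟩
  | some c =>
    have hc := h.isChoice i c hi hy
    have hav : M.Available σ i s := ⟨hX, M.studentPref_trans hs hc.1.2.1, hlt⟩
    have hne : s ≠ c := by
      rintro rfl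
      exact M.studentPref_irrefl _ _ hs
    exact M.studentPref_asymm hs (hc.2 s hav hne)

theorem ncard_mono [Finite I] (h : M.ChoiceStep k σ τ) (s : S) :
    {j | σ j = some (some s)}.ncard ≤ {j | τ j = some (some s)}.ncard :=
  Set.ncard_le_ncard (fun j hj => h.mono j _ hj) (Set.toFinite _)

end ChoiceStep

/-! ### Invariants and properties of the output -/

variable (M) in
/-- The invariants of the mechanism. -/
structure Invariant (k : ℕ) (σ : State I S) : Prop where
  mem : ∀ i s, σ i = some (some s) → (i, s) ∈ M.X
  ncard_le : ∀ s, {j | σ j = some (some s)}.ncard ≤ M.quota s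
  mbPair : ∀ i s, M.MBPair i s → σ i = some (some s)
  quota_le : ∀ i y s, σ i = some y → (i, s) ∈ M.X → M.studentPref i (some s) y →
    M.quota s ≤ {j | σ j = some (some s)}.ncard
  -- The condition on `y` is vacuous for unassigned students: they count as potential enviers, so
  -- this set can only shrink during a run.
  envy : ∀ i s, σ i = some (some s) →
    {i' | M.graph.Adj i i' ∧ (i', s) ∈ M.X ∧ M.schoolPref s (some i') (some i) ∧
      ∀ y, σ i' = some y → M.studentPref i' (some s) y}.ncard < k
  -- Only assigned students must be weakly better off in `Y'`, which makes the statement inductive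
  -- along a run.
  pareto : ∀ Y', M.Feasible Y' →
    (∀ i y, σ i = some y → M.StrictlyBetter i (Y' i) y ∨ Y' i = y) →
    ∀ i y, σ i = some y → Y' i = y

/-- Students in mutually-best pairs have their top school and are its top student, so they neither
envy nor receive envy, and no improvement exists for them. -/
theorem invariant_initState [Finite I] {k : ℕ} (hk : 1 ≤ k)
    (hq : ∀ i s, M.MBPair i s → 1 ≤ M.quota s) : M.Invariant k M.initState := by
  have hmb : ∀ {i : I} {s : S}, M.initState i = some (some s) ↔ M.MBPair i s := by
    simp [initState_eq_some_iff]
  have hbest : ∀ i y s, M.initState i = some y → (i, s) ∈ M.X →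
      ¬ M.studentPref i (some s) y := by
    intro i y s hy hX hs
    obtain ⟨t, rfl, ht⟩ := initState_eq_some_iff.1 hy
    have hne : s ≠ t := by
      rintro rfl
      exact M.studentPref_irrefl _ _ hs
    exact M.studentPref_asymm hs (ht.2.1 s hne hX)
  refine ⟨fun i s h => (hmb.1 h).1, fun s => ?_, fun i s h => hmb.2 h,
    fun i y s hy hX hs => absurd hs (hbest i y s hy hX), fun i s h => ?_, fun Y' hY' h i y hy => ?_⟩
  · by_cases h : ∃ i, M.MBPair i s
    · obtain ⟨i, hi⟩ := h
      refine le_trans ?_ (hq i s hi)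
      exact (Set.ncard_le_one_iff (Set.toFinite _)).2 fun ha hb => (hmb.1 ha).student_unique (hmb.1 hb)
    · have : {j | M.initState j = some (some s)} = ∅ :=
        Set.eq_empty_of_forall_notMem fun j hj => h ⟨j, hmb.1 hj⟩
      simp [this]
  · refine lt_of_eq_of_lt ((Set.ncard_eq_zero (Set.toFinite _)).2 ?_) hk
    refine Set.eq_empty_of_forall_notMem fun j hj => ?_
    exact M.schoolPref_asymm hj.2.2.1 ((hmb.1 h).2.2 j hj.1.ne' hj.2.1)
  · refine (h i y hy).resolve_left ?_
    rintro ⟨t, ht, hp⟩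
    exact hbest i y t hy (hY'.1 i t ht) hp

theorem Invariant.choiceStep [Finite I] {k : ℕ} {σ τ : State I S} (hσ : M.Invariant k σ)
    (h : M.ChoiceStep k σ τ) : M.Invariant k τ := by
  have cases_of : ∀ i y, τ i = some y → σ i = some y ∨ σ i = none := by
    intro i y hy
    cases hi : σ i with
    | none => exact Or.inr rfl
    | some z => rw [h.mono i z hi] at hy; exact Or.inl hy
  refine ⟨fun i s hi => ?_, fun s => ?_, fun i s hi => h.mono _ _ (hσ.mbPair i s hi),
    fun i y s hi hX hs => ?_, fun i s hi => ?_, fun Y' hY' hdom => ?_⟩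
  · rcases cases_of i _ hi with hi' | hi'
    · exact hσ.mem i s hi'
    · exact (h.isChoice i s hi' hi).1.1
  · by_cases hnew : ∃ i, σ i = none ∧ τ i = some (some s)
    · obtain ⟨i, hi, hi'⟩ := hnew
      have hsub : {j | τ j = some (some s)} ⊆ insert i {j | σ j = some (some s)} := by
        intro j hj
        rcases cases_of j _ hj with hj' | hj'
        · exact Or.inr hj'
        · exact Or.inl (h.inj j i s hj' hi hj hi')
      calc _ ≤ (insert i {j | σ j = some (some s)}).ncard :=
            Set.ncard_le_ncard hsub (Set.toFinite _)
        _ ≤ {j | σ j = some (some s)}.ncard + 1 := Set.ncard_insert_le _ _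
        _ ≤ M.quota s := (h.isChoice i s hi hi').1.2.2
    · refine (Set.ncard_le_ncard (fun j hj => ?_) (Set.toFinite _)).trans (hσ.ncard_le s)
      exact (cases_of j _ hj).resolve_right fun hj' => hnew ⟨j, hj', hj⟩
  · refine le_trans ?_ (h.ncard_mono s)
    rcases cases_of i _ hi with hi' | hi'
    · exact hσ.quota_le i y s hi' hX hs
    · exact h.quota_le hi' hi hX hs
  · rcases cases_of i _ hi with hi' | hi'
    · refine (Set.ncard_le_ncard ?_ (Set.toFinite _)).trans_lt (hσ.envy i s hi')
      exact fun j hj => ⟨hj.1, hj.2.1, hj.2.2.1, fun y hy => hj.2.2.2 y (h.mono j y hy)⟩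
    · refine (Set.ncard_le_ncard ?_ (Set.toFinite _)).trans_lt (h.ncard_ahead i s hi' hi)
      rintro j ⟨hadj, hX, hs, henvy⟩
      -- `s` still had a seat in `σ`. A student assigned by now who prefers `s` to her assignment
      -- would require `s` to be full in `σ`, so `j` is still unassigned.
      have hseat := (h.isChoice i s hi' hi).1.2.2
      have hτ : τ j = none := by
        by_contra hne
        obtain ⟨y, hy⟩ := Option.ne_none_iff_exists'.1 hne
        rcases cases_of j y hy with hj | hj
        · exact hseat.not_ge (hσ.quota_le j y s hj hX (henvy y hy))
        · exact hseat.not_ge (h.quota_le hj hy hX (henvy y hy))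
      refine ⟨⟨hadj, ?_, hX, hs⟩, hτ⟩
      by_contra hne
      obtain ⟨y, hy⟩ := Option.ne_none_iff_exists'.1 hne
      rw [h.mono j y hy] at hτ
      cases hτ
  · have hold := hσ.pareto Y' hY' fun i y hy => hdom i y (h.mono i y hy)
    intro i y hy
    rcases cases_of i y hy with hi | hi
    · exact hold i y hi
    · refine (hdom i y hy).resolve_left ?_
      rintro ⟨t, ht, hp⟩
      have hfull := h.quota_le hi hy (hY'.1 i t ht) hp
      -- By induction `Y'` keeps everyone whom `σ` assigns to `t`, and it adds `i`; but `t` was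
      -- already full.
      have hlt : {j | σ j = some (some t)}.ncard < {j | Y' j = some t}.ncard := by
        refine Set.ncard_lt_ncard ⟨fun j hj => hold j _ hj, fun hsub => ?_⟩ (Set.toFinite _)
        have : σ i = some (some t) := hsub ht
        rw [hi] at this
        cases this
      exact (hfull.trans_lt hlt).not_ge (hY'.2 t)

theorem Invariant.of_output {k : ℕ} {σ : State I S} (hσ : M.Invariant k σ)
    {Y : I → Option S} (hY : ∀ i, σ i = some (Y i)) [Finite I] :
    M.Feasible Y ∧ M.ParetoEfficient Y ∧ M.LocallyERF (k - 1) Y ∧ M.MutuallyBest Y := by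
  have hiff : ∀ i y, σ i = some y ↔ Y i = y := fun i y => by rw [hY, Option.some.injEq]
  have hfeas : M.Feasible Y := by
    refine ⟨fun i s hi => hσ.mem i s ((hiff _ _).2 hi), fun s => ?_⟩
    simpa only [hiff] using hσ.ncard_le s
  refine ⟨hfeas, ⟨hfeas, fun Y' hY' hdom => ?_⟩, fun i => ?_,
    fun i s hi => (hiff _ _).1 (hσ.mbPair i s hi)⟩
  · have heq := hσ.pareto Y' hY' fun i y hy => by
      obtain rfl := (hiff _ _).1 hy
      exact hdom.1 i
    obtain ⟨i, s, hs, hp⟩ := hdom.2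
    rw [heq i _ (hY i)] at hs
    rw [hs] at hp
    exact M.studentPref_irrefl _ _ hp
  · cases hi : Y i with
    | none =>
      have : {i' | M.graph.Adj i i' ∧ M.JustifiedEnvy Y i' i} = ∅ := by
        refine Set.eq_empty_of_forall_notMem ?_
        rintro j ⟨-, s, -, -, hs, -⟩
        rw [hi] at hs
        cases hs
      simp [this]
    | some s =>
      refine Nat.le_sub_one_of_lt ?_
      refine (Set.ncard_le_ncard ?_ (Set.toFinite _)).trans_lt (hσ.envy i s ((hiff _ _).2 hi))
      rintro j ⟨hadj, t, hX, hp, ht, hs⟩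
      obtain rfl : s = t := Option.some.inj (hi.symm.trans ht)
      refine ⟨hadj, hX, hs, fun y hy => ?_⟩
      rw [← (hiff _ _).1 hy]
      exact hp

/-! ### Absence of deadlock -/

/-- If every vertex of a nonempty set `U` has at least `k ≥ 1` in-neighbors in `U` that are
graph neighbors, while each vertex has at most `k` neighbors above it in some linear order,
then two vertices are in-neighbors of each other. -/
theorem exists_mutual [Finite I] {k : ℕ} (hk : 1 ≤ k) (G : SimpleGraph I)
    (r : I → I → Prop) [IsStrictTotalOrder I r]
    (hr : ∀ i, {i' | G.Adj i i' ∧ r i' i}.ncard ≤ k) {U : Set I} (hU : U.Nonempty)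
    (A : I → Set I) (hA : ∀ i ∈ U, ∀ i' ∈ A i, G.Adj i i' ∧ i' ∈ U)
    (hcard : ∀ i ∈ U, k ≤ (A i).ncard) :
    ∃ i ∈ U, ∃ i' ∈ U, i' ∈ A i ∧ i ∈ A i' := by
  classical
  by_contra! hno
  have := Fintype.ofFinite I
  obtain ⟨a, ha, hmin⟩ := (Finite.wellFounded_of_trans_of_irrefl r).has_min U hU
  -- `f` rewrites an attack as its underlying edge, with the lower-ranked end first. `P` collects
  -- the attacks, `Q` the candidate edges. The `r`-top vertex `a` of `U` is never a lower end, hence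
  -- the `erase` in `Q`.
  let f : (_ : I) × I → (_ : I) × I := fun p => if r p.2 p.1 then p else ⟨p.2, p.1⟩
  let P : Finset ((_ : I) × I) := U.toFinset.sigma fun i => (A i).toFinset
  let Q : Finset ((_ : I) × I) := (U.toFinset.erase a).sigma fun i =>
    {i' | G.Adj i i' ∧ r i' i}.toFinset
  have hP : U.toFinset.card * k ≤ P.card := by
    rw [Finset.card_sigma, ← smul_eq_mul]
    refine Finset.card_nsmul_le_sum _ _ _ fun i hi => ?_
    rw [← Set.ncard_eq_toFinset_card']
    exact hcard i (Set.mem_toFinset.1 hi)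
  have hQ : Q.card ≤ (U.toFinset.erase a).card * k := by
    rw [Finset.card_sigma, ← smul_eq_mul]
    refine Finset.sum_le_card_nsmul _ _ _ fun i _ => ?_
    rw [← Set.ncard_eq_toFinset_card']
    exact hr i
  have hmaps : ∀ p ∈ P, f p ∈ Q := by
    rintro ⟨i, j⟩ hp
    simp only [P, Finset.mem_sigma, Set.mem_toFinset] at hp
    obtain ⟨hadj, hj⟩ := hA i hp.1 j hp.2
    have hmem : ∀ x ∈ U, ∀ y ∈ U, G.Adj x y → r y x → (⟨x, y⟩ : (_ : I) × I) ∈ Q := by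
      intro x hx y hy hxy hryx
      simp only [Q, Finset.mem_sigma, Finset.mem_erase, Set.mem_toFinset, Set.mem_ofPred_eq]
      refine ⟨⟨?_, hx⟩, hxy, hryx⟩
      rintro rfl
      exact hmin y hy hryx
    simp only [f]
    split_ifs with hji
    · exact hmem i hp.1 j hj hadj hji
    · refine hmem j hj i hp.1 hadj.symm ?_
      rcases trichotomous_of r i j with h | h | h
      · exact h
      · exact absurd h hadj.ne
      · exact absurd h hji
  -- Two attacks with the same underlying edge are equal or reverse to each other, and `hno`
  -- excludes the latter.
  have hinj : Set.InjOn f P := by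
    rintro ⟨i, j⟩ hp ⟨i', j'⟩ hp' heq
    simp only [P, Finset.mem_coe, Finset.mem_sigma, Set.mem_toFinset] at hp hp'
    simp only [f] at heq
    have hj := (hA i hp.1 j hp.2).2
    split_ifs at heq with h₁ h₂ h₂
    · exact heq
    · cases heq
      exact absurd hp'.2 (hno _ hp.1 _ hj hp.2)
    · cases heq
      exact absurd hp'.2 (hno _ hp.1 _ hj hp.2)
    · cases heq
      rfl
  have hle := hP.trans ((Finset.card_le_card_of_injOn f hmaps hinj).trans hQ)
  have hlt := Finset.card_erase_lt_of_mem (Set.mem_toFinset.2 ha)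
  exact hlt.not_ge (Nat.le_of_mul_le_mul_right hle hk)

/-- A state with an unassigned student admits a step. -/
theorem exists_bltStep [Finite I] [Finite S] {k : ℕ} (hk : 1 ≤ k) (hbound : ∀ s i,
    {i' | M.graph.Adj i i' ∧ M.schoolPref s (some i') (some i)}.ncard ≤ k)
    {σ : State I S} (hσ : ¬ AllAssigned σ) : ∃ τ, M.BLTStep k σ τ := by
  by_cases hgreedy : ∃ τ, M.GreedyStep k σ τ
  · exact hgreedy.imp fun _ => Or.inl
  have hchoice : ∀ i, σ i = none → ∃ s, M.IsChoice σ i s := fun i hi => by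
    refine exists_isChoice ?_
    by_contra! h
    exact hgreedy ⟨_, .toEmpty i hi h⟩
  have hU : {i | σ i = none}.Nonempty := by
    unfold AllAssigned at hσ
    push Not at hσ
    exact hσ
  -- Attacks are judged by different schools, but the edge count needs a single linear order; that
  -- of an arbitrary school will do.
  obtain ⟨s₀, -⟩ := hchoice _ hU.some_mem
  have hs₀ := M.schoolPref_order s₀
  have : IsStrictTotalOrder I fun i i' => M.schoolPref s₀ (some i) (some i') :=
    { irrefl := fun i => M.schoolPref_irrefl s₀ _
      trans := fun _ _ _ => M.schoolPref_trans
      trichotomous := fun i j h h' => Option.some.inj (hs₀.trichotomous _ _ h h') }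
  obtain ⟨i, hi, i', hi', h, h'⟩ := exists_mutual hk M.graph
    (fun i i' => M.schoolPref s₀ (some i) (some i')) (hbound s₀) hU
    (fun i => {i' | M.Attacks σ i' i})
    (fun i _ i' ⟨_, _, h⟩ => ⟨h.1, h.2.1⟩) fun i hi => by
      obtain ⟨s, hs⟩ := hchoice i hi
      have hle : k ≤ (M.Ahead σ i s).ncard := by
        by_contra! hlt
        exact hgreedy ⟨_, .toSchool i s hi hs hlt⟩
      exact hle.trans (Set.ncard_le_ncard (fun j hj => ⟨s, hs, hj⟩) (Set.toFinite _))
  obtain ⟨s, hs⟩ := hchoice i hi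
  obtain ⟨s', hs'⟩ := hchoice i' hi'
  exact ⟨_, Or.inr ⟨fun ρ hρ => hgreedy ⟨ρ, hρ⟩, .mk i i' s s' hi hi' hs hs' h h'⟩⟩

/-- Shows that an output exists, so that the claims about all outputs are not vacuous. -/
theorem exists_allAssigned_of_step [Finite I] {k : ℕ}
    (hstep : ∀ σ τ, M.BLTStep k σ τ → {i | τ i = none}.ncard < {i | σ i = none}.ncard)
    (hex : ∀ σ, ¬ AllAssigned σ → ∃ τ, M.BLTStep k σ τ) (σ : State I S) :
    ∃ τ, Relation.ReflTransGen (M.BLTStep k) σ τ ∧ AllAssigned τ := by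
  induction hn : {i | σ i = none}.ncard using Nat.strong_induction_on generalizing σ with
  | _ n ih =>
    by_cases hσ : AllAssigned σ
    · exact ⟨σ, .refl, hσ⟩
    · obtain ⟨τ, hτ⟩ := hex σ hσ
      obtain ⟨ρ, hρ, hall⟩ := ih _ (hn ▸ hstep σ τ hτ) τ rfl
      exact ⟨ρ, .head hτ hρ, hall⟩

end Market

theorem mainTheorem2 {I S : Type*} [Finite I] [Finite S] (M : Market I S) (k : ℕ)
    (hk : 1 ≤ k)
    (hq : ∀ i s, M.MBPair i s → 1 ≤ M.quota s)
    (htw : HasTreewidth M.graph k)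
    (hsp : ∀ s, ∃ T : TreeDecomposition M.graph, T.HasWidth k ∧
      T.SinglePeaked (fun i i' => M.schoolPref s (some i) (some i'))) :
    M.BLTTerminates k ∧
      (∃ Y, M.BLTOutput k Y) ∧
      ∀ Y, M.BLTOutput k Y →
        M.Feasible Y ∧ M.ParetoEfficient Y ∧ M.LocallyERF (k - 1) Y ∧
          M.MutuallyBest Y := by
  have hbound : ∀ s i,
      {i' | M.graph.Adj i i' ∧ M.schoolPref s (some i') (some i)}.ncard ≤ k := fun s i => by
    obtain ⟨T, hT, hpeak⟩ := hsp s
    exact hpeak.ncard_adj_le hT (fun _ _ => M.schoolPref_asymm) i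
  have hstep : ∀ σ τ, M.BLTStep k σ τ → M.ChoiceStep k σ τ :=
    fun _ _ h => h.choiceStep hbound
  have hex : ∀ σ : Market.State I S, ¬ Market.AllAssigned σ → ∃ τ, M.BLTStep k σ τ :=
    fun _ => Market.exists_bltStep hk hbound
  refine ⟨⟨?_, fun σ _ => hex σ⟩, ?_, ?_⟩
  · rintro ⟨run, -, hrun⟩
    obtain ⟨n, hn⟩ := WellFounded.not_rel_apply_succ (r := (· < ·))
      fun t => {i | run t i = none}.ncard
    exact hn (hstep _ _ (hrun n)).ncard_unassigned_lt
  · obtain ⟨σ, hreach, hall⟩ := Market.exists_allAssigned_of_step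
      (fun σ τ h => (hstep σ τ h).ncard_unassigned_lt) hex M.initState
    choose Y hY using fun i => Option.ne_none_iff_exists'.1 (hall i)
    exact ⟨Y, σ, hreach, hall, hY⟩
  · rintro Y ⟨σ, hreach, -, hY⟩
    have hinv : M.Invariant k σ := by
      clear hY
      induction hreach with
      | refl => exact Market.invariant_initState hk hq
      | tail _ h ih => exact ih.choiceStep (hstep _ _ h)
    exact hinv.of_output hY
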